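/- **Theorem (quaternionic Liouville formula).** Let $\mathbb H$ be the real quaternions, let $I\subseteq\mathbb R$ be an interval, and let $A:I\to\mathbb H^{n\times n}$ be continuous. Let $x_1,\dots,x_n:I\to\mathbb H^n$ be solutions on $I$ of the linear system $\dot x=A(t)x$, and let $M(t)$ be the $n\times n$ matrix with columns $x_1(t),\dots,x_n(t)$. For a quaternionic matrix $B=(b_{ij})\in\mathbb H^{n\times n}$ the permutation determinant is $$\det\nolimits_P B=\sum_{\sigma\in S_n}\varepsilon(\sigma)\,b_{n_1i_2}b_{i_2i_3}\cdots b_{i_sn_1}\,b_{n_2j_2}\cdots b_{j_tn_2}\cdots b_{n_rk_2}\cdots b_{k_ln_r},$$ where $\sigma=(n_1i_2\cdots i_s)(n_2j_2\cdots j_t)\cdots(n_rk_2\cdots k_l)$ is the disjoint cycle decomposition (fixed points included) written so that each cycle begins with its largest element and $n_1>n_2>\cdots>n_r$, and $\varepsilon(\sigma)=(-1)^{n-r}$. The Wronskian is $$W_{QDE}(t)=\tfrac12\,\mathrm{ddet}\,M(t)=\tfrac12\det\nolimits_P\big(M^+(t)M(t)\big),$$ with $M^+$ the conjugate transpose of $M$.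 Then for all $t_0,t\in I$ $$W_{QDE}(t)=\exp\Big(\int_{t_0}^t\big[\operatorname{tr}A(s)+\operatorname{tr}A^+(s)\big]\,ds\Big)W_{QDE}(t_0),$$ equivalently $$W_{QDE}(t)=\exp\Big(2\int_{t_0}^t\operatorname{Re}\operatorname{tr}A(s)\,ds\Big)W_{QDE}(t_0).$$ Moreover, if $W_{QDE}(t_0)=0$ for some $t_0\in I$, then $W_{QDE}(t)=0$ for all $t\in I$. -/

import Mathlib

open scoped Quaternion Matrix

namespace QuatLiouville

/-- The leading letters of the cycles of `σ` (fixed points count as cycles of length one) in the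
normal form of `σ`: the largest element of each cycle, listed in decreasing order
`n₁ > n₂ > ⋯ > n_r`. -/
def cycleLeaders {n : ℕ} (σ : Equiv.Perm (Fin n)) : List (Fin n) :=
  (List.finRange n).reverse.filter fun m => ∀ j, σ.SameCycle m j → j ≤ m

/-- The number of elements of the cycle of `σ` through `m` (one if `m` is fixed). -/
def cycleLength {n : ℕ} (σ : Equiv.Perm (Fin n)) (m : Fin n) : ℕ :=
  (Finset.univ.filter fun j => σ.SameCycle m j).card

/-- The ordered product `a_{m i₂} a_{i₂ i₃} ⋯ a_{i_s m}` along the cycle `(m i₂ ⋯ i_s)` of `σ`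
through `m`, where `i_{k+1} = σ^k m`. -/
def cycleWord {R : Type*} [Ring R] {n : ℕ} (a : Matrix (Fin n) (Fin n) R)
    (σ : Equiv.Perm (Fin n)) (m : Fin n) : R :=
  ((List.range (cycleLength σ m)).map fun k => a ((σ ^ k) m) ((σ ^ (k + 1)) m)).prod

/-- Chen's permutation determinant `det_P`: the signed sum over all permutations of the ordered
products of the cycle words, the cycles being written in normal form.  For a permutation of `n`
letters with `r` cycles (fixed points included) the sign is `(-1)^(n-r)`. -/
def detP {R : Type*} [Ring R] {n : ℕ} (a : Matrix (Fin n) (Fin n) R) : R :=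
  ∑ σ : Equiv.Perm (Fin n),
    ((Equiv.Perm.sign σ : ℤ) : R) * ((cycleLeaders σ).map (cycleWord a σ)).prod

/-- The double determinant `ddet M = det_P (M⁺ M)`, with `M⁺` the conjugate transpose. -/
noncomputable def ddet {n m : ℕ} (M : Matrix (Fin n) (Fin m) ℍ) : ℍ :=
  detP (Mᴴ * M)

/-- `x` solves `ẋ = A(t) x` on `I` (one-sided derivatives at endpoints belonging to `I`). -/
def IsSolutionOn {n : ℕ} (A : ℝ → Matrix (Fin n) (Fin n) ℍ) (I : Set ℝ)
    (x : ℝ → Fin n → ℍ) : Prop :=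
  ∀ t ∈ I, HasDerivWithinAt x (A t *ᵥ x t) I t

/-- The matrix `M(t)` whose `j`-th column is `x_j(t)`. -/
def solutionMatrix {n : ℕ} (x : Fin n → ℝ → Fin n → ℍ) (t : ℝ) : Matrix (Fin n) (Fin n) ℍ :=
  Matrix.of fun i j => x j t i

/-- The Wronskian `W(t) = ½ ddet M(t)`, as a quaternion. -/
noncomputable def wronskian {n : ℕ} (x : Fin n → ℝ → Fin n → ℍ) (t : ℝ) : ℍ :=
  (1 / 2 : ℝ) • ddet (solutionMatrix x t)

end QuatLiouville

namespace QuatLiouville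

/-! Put H = MᴴM. Along solutions H' = (AM)ᴴM + Mᴴ(AM), so the point is that the derivative of `detP`
at H in this direction is 2 Re tr A times `detP` H (`detPDeriv_conjTranspose_mul_self`); a scalar
linear equation then gives the formula. For invertible M the direction is BᴴH + HB with B = M⁻¹AM,
tangent to the congruences H ↦ gᴴHg; singular M follow by density.

So it suffices to know how `detP` of a Hermitian matrix scales under congruence by 1 + qE_ij
(`detP_congruence`). Deleting the smallest letter from its cycle gives `detP_succ`: with G the minor
and v, w the rest of column and row 0, `detP` H = `detP` G · H₀₀ − D`detP`(G)[vw]. A scaling law in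
size n can be differentiated, hence passes to size n + 1 when the letter 0 is untouched. Invariance
under relabelling (`detP_submatrix_perm`) moves an untouched letter to 0, which leaves only sizes
one and two. -/

/-- The cycle of `σ` through `m`, listed from `m`. -/
def cycleList {n : ℕ} (σ : Equiv.Perm (Fin n)) (m : Fin n) : List (Fin n) :=
  (List.range (cycleLength σ m)).map fun k => (σ ^ k) m

lemma cycleWord_eq_prod {R : Type*} [Ring R] {n : ℕ} (a : Matrix (Fin n) (Fin n) R)
    (σ : Equiv.Perm (Fin n)) (m : Fin n) :
    cycleWord a σ m = ((cycleList σ m).map fun b => a b (σ b)).prod := by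
  simp [cycleWord, cycleList, pow_succ', Function.comp_def]

lemma cycleLength_eq_card_support {n : ℕ} (σ : Equiv.Perm (Fin n)) (m : Fin n) (h : σ m ≠ m) :
    cycleLength σ m = (σ.cycleOf m).support.card := by
  unfold cycleLength
  congr 1
  ext j
  simp [Equiv.Perm.mem_support_cycleOf_iff' h]

lemma cycleLength_of_fixed {n : ℕ} (σ : Equiv.Perm (Fin n)) (m : Fin n) (h : σ m = m) :
    cycleLength σ m = 1 := by
  unfold cycleLength
  rw [Finset.card_eq_one]
  refine ⟨m, ?_⟩
  ext j
  simp only [Finset.mem_filter, Finset.mem_univ, true_and, Finset.mem_singleton]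
  refine ⟨fun hj => ?_, fun hj => hj ▸ Equiv.Perm.SameCycle.refl _ _⟩
  exact (hj.eq_of_left h).symm

lemma mem_cycleList {n : ℕ} (σ : Equiv.Perm (Fin n)) (m j : Fin n) :
    j ∈ cycleList σ m ↔ σ.SameCycle m j := by
  simp only [cycleList, List.mem_map, List.mem_range]
  constructor
  · rintro ⟨k, -, rfl⟩
    exact ⟨k, by simp⟩
  · intro h
    by_cases hm : σ m = m
    · exact ⟨0, by simp [cycleLength_of_fixed σ m hm], h.eq_of_left hm⟩
    · obtain ⟨i, hi, e⟩ := h.exists_pow_eq_of_mem_support (by simpa using hm)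
      exact ⟨i, by rwa [cycleLength_eq_card_support σ m hm], e⟩

lemma toFinset_cycleList {n : ℕ} (σ : Equiv.Perm (Fin n)) (m : Fin n) :
    (cycleList σ m).toFinset = Finset.univ.filter fun j => σ.SameCycle m j := by
  ext j
  simp [mem_cycleList]

lemma nodup_cycleList {n : ℕ} (σ : Equiv.Perm (Fin n)) (m : Fin n) : (cycleList σ m).Nodup := by
  refine (Multiset.toFinset_card_eq_card_iff_nodup (m := (cycleList σ m : Multiset (Fin n)))).mp ?_
  change (cycleList σ m).toFinset.card = (cycleList σ m).length
  rw [toFinset_cycleList]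
  simp [cycleList, cycleLength]

/-! ### Inserting the smallest letter into a permutation -/

section Insert

variable {n : ℕ} (e : Equiv.Perm (Fin n)) (k : Fin n)

lemma decomposeFin_symm_succ_apply_succ (b : Fin n) :
    Equiv.Perm.decomposeFin.symm (k.succ, e) b.succ = if e b = k then 0 else (e b).succ := by
  rw [Equiv.Perm.decomposeFin_symm_apply_succ]
  split_ifs with h
  · simp [h]
  · exact Equiv.swap_apply_of_ne_of_ne (Fin.succ_ne_zero _) (by simpa using h)

lemma decomposeFin_symm_zero_pow_apply_succ (i : ℕ) (b : Fin n) :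
    (Equiv.Perm.decomposeFin.symm (0, e) ^ i) b.succ = ((e ^ i) b).succ := by
  induction i with
  | zero => simp
  | succ i ih => simp [pow_succ', ih, Equiv.Perm.decomposeFin_symm_apply_succ]

lemma sameCycle_decomposeFin_symm_zero_iff (b c : Fin n) :
    (Equiv.Perm.decomposeFin.symm (0, e)).SameCycle b.succ c.succ ↔ e.SameCycle b c := by
  constructor
  · intro h
    obtain ⟨i, -, hi⟩ := h.exists_pow_eq'
    rw [decomposeFin_symm_zero_pow_apply_succ, Fin.succ_inj] at hi
    exact ⟨i, by simpa using hi⟩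
  · intro h
    obtain ⟨i, -, hi⟩ := h.exists_pow_eq'
    exact ⟨i, by rw [zpow_natCast, decomposeFin_symm_zero_pow_apply_succ, hi]⟩

lemma not_sameCycle_decomposeFin_symm_zero (b : Fin n) :
    ¬ (Equiv.Perm.decomposeFin.symm (0, e)).SameCycle b.succ 0 := by
  intro h
  obtain ⟨i, -, hi⟩ := h.exists_pow_eq'
  rw [decomposeFin_symm_zero_pow_apply_succ] at hi
  exact Fin.succ_ne_zero _ hi

/-- Removing `0` from its cycle does not change which other letters share a cycle. -/
lemma sameCycle_decomposeFin_symm_succ_iff (y z : Fin (n + 1)) :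
    (Equiv.Perm.decomposeFin.symm (k.succ, e)).SameCycle y z ↔
      e.SameCycle (Fin.cases k id y : Fin n) (Fin.cases k id z : Fin n) := by
  set σ := Equiv.Perm.decomposeFin.symm (k.succ, e) with hσ
  -- Collapsing `0` onto `k` turns a step of `σ` into a step of `e`, or into no step when starting
  -- from `0`.
  have step (y : Fin (n + 1)) :
      e.SameCycle (Fin.cases k id y : Fin n) (Fin.cases k id (σ y) : Fin n) := by
    refine Fin.cases ?_ (fun b => ?_) y
    · simp [hσ, Equiv.Perm.SameCycle.refl]
    · rw [hσ, decomposeFin_symm_succ_apply_succ]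
      split_ifs with h
      · simp [← h, Equiv.Perm.SameCycle.refl]
      · simp [Equiv.Perm.SameCycle.refl]
  have forth (y z : Fin (n + 1)) (h : σ.SameCycle y z) :
      e.SameCycle (Fin.cases k id y : Fin n) (Fin.cases k id z : Fin n) := by
    obtain ⟨i, -, rfl⟩ := h.exists_pow_eq'
    clear h
    induction i with
    | zero => exact Equiv.Perm.SameCycle.refl _ _
    | succ i ih => rw [pow_succ', Equiv.Perm.mul_apply]; exact ih.trans (step _)
  have zero_k : σ.SameCycle 0 k.succ := ⟨1, by simp [hσ]⟩
  have lift (y : Fin (n + 1)) : σ.SameCycle y (Fin.cases k id y : Fin n).succ :=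
    Fin.cases zero_k (fun b => Equiv.Perm.SameCycle.refl _ _) y
  have back_step (b : Fin n) : σ.SameCycle b.succ (e b).succ := by
    have h : σ b.succ = if e b = k then 0 else (e b).succ := decomposeFin_symm_succ_apply_succ e k b
    split_ifs at h with hb
    · rw [hb]
      exact Equiv.Perm.SameCycle.trans ⟨1, by simpa using h⟩ zero_k
    · exact ⟨1, by simpa using h⟩
  refine ⟨forth y z, fun h => ((lift y).trans ?_).trans (lift z).symm⟩
  generalize (Fin.cases k id y : Fin n) = b at h
  generalize (Fin.cases k id z : Fin n) = c at h
  obtain ⟨i, -, rfl⟩ := h.exists_pow_eq'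
  clear h
  induction i with
  | zero => exact Equiv.Perm.SameCycle.refl _ _
  | succ i ih => rw [pow_succ', Equiv.Perm.mul_apply]; exact ih.trans (back_step _)

lemma map_succ_cycleList (m : Fin n) :
    cycleList (Equiv.Perm.decomposeFin.symm (0, e)) m.succ = (cycleList e m).map Fin.succ := by
  have : cycleLength (Equiv.Perm.decomposeFin.symm (0, e)) m.succ = cycleLength e m := by
    unfold cycleLength
    rw [Fin.card_filter_univ_succ, if_neg (not_sameCycle_decomposeFin_symm_zero e m)]
    simp only [sameCycle_decomposeFin_symm_zero_iff]
  simp [cycleList, this, decomposeFin_symm_zero_pow_apply_succ]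

/-- The cycle grows by one exactly when it contains `k`, equivalently the unique `b` with `e b = k`.
This count fixes where the list identity below stops. -/
lemma cycleLength_decomposeFin_symm_succ (m : Fin n) :
    cycleLength (Equiv.Perm.decomposeFin.symm (k.succ, e)) m.succ =
      ((cycleList e m).flatMap fun b => if e b = k then [b.succ, 0] else [b.succ]).length := by
  have h1 : ∀ b : Fin n, (if e b = k then [b.succ, 0] else [b.succ]).length =
      1 + if e b = k then 1 else 0 := fun b => by split_ifs <;> rfl
  rw [List.length_flatMap]
  simp only [h1]
  rw [← List.sum_toFinset _ (nodup_cycleList e m), toFinset_cycleList, Finset.sum_add_distrib]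
  unfold cycleLength
  rw [Fin.card_filter_univ_succ]
  simp only [sameCycle_decomposeFin_symm_succ_iff, Fin.cases_zero,
    Fin.cases_succ, id, Finset.sum_const, smul_eq_mul, mul_one]
  have h2 : (∑ b ∈ Finset.univ.filter (fun j => e.SameCycle m j), if e b = k then 1 else 0) =
      if e.SameCycle m k then 1 else 0 := by
    have : ∀ b, e b = k ↔ b = e.symm k := fun b => by rw [Equiv.eq_symm_apply]
    simp only [this, Finset.sum_ite_eq', Finset.mem_filter, Finset.mem_univ, true_and]
    simp only [Equiv.Perm.sameCycle_symm_apply_right]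
  rw [h2]
  split_ifs <;> omega

lemma cycleList_decomposeFin_symm_succ (m : Fin n) :
    cycleList (Equiv.Perm.decomposeFin.symm (k.succ, e)) m.succ =
      (cycleList e m).flatMap fun b => if e b = k then [b.succ, 0] else [b.succ] := by
  set σ := Equiv.Perm.decomposeFin.symm (k.succ, e) with hσ
  set F : Fin n → List (Fin (n + 1)) := fun b => if e b = k then [b.succ, 0] else [b.succ] with hF
  -- The second clause records where `σ` stands after the first `j` letters of `e`, so that the
  -- induction can continue.
  have key (j : ℕ) : ((List.range j).map fun i => (e ^ i) m).flatMap F =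
      (List.range (((List.range j).map fun i => (e ^ i) m).flatMap F).length).map
        (fun i => (σ ^ i) m.succ) ∧
      (σ ^ (((List.range j).map fun i => (e ^ i) m).flatMap F).length) m.succ =
        ((e ^ j) m).succ := by
    induction j with
    | zero => simp
    | succ j ih =>
      obtain ⟨ih1, ih2⟩ := ih
      set l := ((List.range j).map fun i => (e ^ i) m).flatMap F
      have hl : ((List.range (j + 1)).map fun i => (e ^ i) m).flatMap F = l ++ F ((e ^ j) m) := by
        simp [List.range_succ, l]
      have hs : σ ((e ^ j) m).succ = if e ((e ^ j) m) = k then 0 else (e ((e ^ j) m)).succ :=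
        decomposeFin_symm_succ_apply_succ e k _
      have h0 : σ 0 = k.succ := by simp [hσ]
      rw [hl]
      by_cases h : e ((e ^ j) m) = k
      · rw [if_pos h] at hs
        have hFj : F ((e ^ j) m) = [((e ^ j) m).succ, 0] := if_pos h
        have hl1 : (σ ^ (l.length + 1)) m.succ = 0 := by
          rw [pow_succ', Equiv.Perm.mul_apply, ih2, hs]
        rw [hFj]
        constructor
        · simp only [List.length_append, List.length_cons, List.length_nil, zero_add]
          rw [show l.length + (1 + 1) = (l.length + 1) + 1 from rfl, List.range_succ,
            List.range_succ, List.map_append, List.map_append, ← ih1]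
          simp [ih2, hl1]
        · simp only [List.length_append, List.length_cons, List.length_nil, zero_add]
          rw [show l.length + (1 + 1) = (l.length + 1) + 1 from rfl, pow_succ',
            Equiv.Perm.mul_apply, hl1, h0, pow_succ', Equiv.Perm.mul_apply, h]
      · rw [if_neg h] at hs
        have hFj : F ((e ^ j) m) = [((e ^ j) m).succ] := if_neg h
        rw [hFj]
        constructor
        · simp only [List.length_append, List.length_cons, List.length_nil, zero_add]
          rw [List.range_succ, List.map_append, ← ih1]
          simp [ih2]
        · simp only [List.length_append, List.length_cons, List.length_nil, zero_add]
          rw [pow_succ', Equiv.Perm.mul_apply, ih2, hs, pow_succ', Equiv.Perm.mul_apply]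
  have h := (key (cycleLength e m)).1
  have hlen := cycleLength_decomposeFin_symm_succ e k m
  rw [← hσ] at hlen
  change ((cycleList e m).flatMap F) = List.map _ (List.range ((cycleList e m).flatMap F).length) at h
  rw [h, ← hlen]
  rfl

lemma cycleLeaders_decomposeFin_symm_zero :
    cycleLeaders (Equiv.Perm.decomposeFin.symm (0, e)) = (cycleLeaders e).map Fin.succ ++ [0] := by
  unfold cycleLeaders
  have h0 (j : Fin (n + 1)) (h : (Equiv.Perm.decomposeFin.symm (0, e)).SameCycle 0 j) : j ≤ 0 :=
    (h.eq_of_left (by simp [Function.IsFixedPt])).symm.le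
  rw [List.finRange_succ, List.reverse_cons, List.filter_append, ← List.map_reverse,
    List.filter_map]
  congr 1
  · congr 1
    apply List.filter_congr
    intro m _
    simp [Fin.forall_fin_succ, sameCycle_decomposeFin_symm_zero_iff]
  · simp only [List.filter_cons, List.filter_nil]
    rw [if_pos]
    simpa using h0

/-- The letter `0` shares its cycle with the larger `k.succ`, so it never leads, and being smallest
it displaces no other leader. -/
lemma cycleLeaders_decomposeFin_symm_succ :
    cycleLeaders (Equiv.Perm.decomposeFin.symm (k.succ, e)) = (cycleLeaders e).map Fin.succ := by
  unfold cycleLeaders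
  rw [List.finRange_succ, List.reverse_cons, List.filter_append, ← List.map_reverse,
    List.filter_map]
  have : List.filter (fun m => decide (∀ j, (Equiv.Perm.decomposeFin.symm (k.succ, e)).SameCycle m j
      → j ≤ m)) [0] = [] := by
    simp only [List.filter_cons, List.filter_nil]
    rw [if_neg]
    simp only [decide_eq_true_eq, not_forall]
    exact ⟨k.succ, ⟨1, by simp⟩, by simp⟩
  rw [this, List.append_nil]
  congr 1
  apply List.filter_congr
  intro m _
  simp [Fin.forall_fin_succ, sameCycle_decomposeFin_symm_succ_iff]

end Insert

/-! ### The recursion for `detP` -/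

section Recursion

variable {R : Type*} [Ring R] {n : ℕ}

lemma cycleWord_decomposeFin_symm_zero (H : Matrix (Fin (n + 1)) (Fin (n + 1)) R)
    (e : Equiv.Perm (Fin n)) (m : Fin n) :
    cycleWord H (Equiv.Perm.decomposeFin.symm (0, e)) m.succ =
      cycleWord (H.submatrix Fin.succ Fin.succ) e m := by
  rw [cycleWord_eq_prod, cycleWord_eq_prod, map_succ_cycleList]
  simp [Function.comp_def, Equiv.Perm.decomposeFin_symm_apply_succ]

/-- Inserting `0` right after `a` splits one factor in two without disturbing the order of the
others, which is a change of row `a` in the minor. -/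
lemma cycleWord_decomposeFin_symm_succ (H : Matrix (Fin (n + 1)) (Fin (n + 1)) R)
    (e : Equiv.Perm (Fin n)) (a m : Fin n) :
    cycleWord H (Equiv.Perm.decomposeFin.symm ((e a).succ, e)) m.succ =
      cycleWord ((H.submatrix Fin.succ Fin.succ).updateRow a
        fun c => H a.succ 0 * H 0 c.succ) e m := by
  rw [cycleWord_eq_prod, cycleWord_eq_prod, cycleList_decomposeFin_symm_succ]
  induction cycleList e m with
  | nil => simp
  | cons b l ih =>
    rw [List.flatMap_cons, List.map_append, List.prod_append, ih, List.map_cons, List.prod_cons]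
    congr 1
    have hs := decomposeFin_symm_succ_apply_succ e (e a) b
    by_cases hb : b = a
    · subst hb
      simp
    · have hne : e b ≠ e a := fun h => hb (e.injective h)
      rw [if_neg hne] at hs ⊢
      simp only [List.map_cons, List.map_nil, List.prod_singleton, hs,
        Matrix.updateRow_ne hb, Matrix.submatrix_apply]

/-- Expansion of `det_P` by removal of the smallest letter from its cycle. -/
theorem detP_succ (H : Matrix (Fin (n + 1)) (Fin (n + 1)) R) :
    detP H = detP (H.submatrix Fin.succ Fin.succ) * H 0 0 -
      ∑ a, detP ((H.submatrix Fin.succ Fin.succ).updateRow a fun c => H a.succ 0 * H 0 c.succ) := by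
  unfold detP
  rw [← Equiv.sum_comp Equiv.Perm.decomposeFin.symm, Fintype.sum_prod_type_right,
    Finset.sum_mul]
  conv_rhs => rw [Finset.sum_comm]
  rw [← Finset.sum_sub_distrib]
  refine Finset.sum_congr rfl fun e _ => ?_
  rw [Fin.sum_univ_succ, sub_eq_add_neg]
  congr 1
  · have h0 : cycleWord H (Equiv.Perm.decomposeFin.symm (0, e)) 0 = H 0 0 := by
      simp [cycleWord, cycleLength_of_fixed]
    rw [cycleLeaders_decomposeFin_symm_zero, Equiv.Perm.decomposeFin.symm_sign]
    simp [h0, Function.comp_def, cycleWord_decomposeFin_symm_zero, mul_assoc]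
  -- Index the insertions by the predecessor `a` of `0` instead of its successor `e a`.
  · rw [← Equiv.sum_comp e, ← Finset.sum_neg_distrib]
    refine Finset.sum_congr rfl fun a _ => ?_
    rw [cycleLeaders_decomposeFin_symm_succ, Equiv.Perm.decomposeFin.symm_sign]
    simp [Function.comp_def, cycleWord_decomposeFin_symm_succ]

lemma detP_zero (H : Matrix (Fin 0) (Fin 0) R) : detP H = 1 := by
  simp [detP, cycleLeaders]

end Recursion

/-! ### Linearity of `detP` in each row -/

lemma updateRow_updateRow_comm {R : Type*} {n : ℕ} {i j : Fin n} (h : i ≠ j)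
    (H : Matrix (Fin n) (Fin n) R)
    (u v : Fin n → R) : (H.updateRow i u).updateRow j v = (H.updateRow j v).updateRow i u := by
  ext a b
  simp only [Matrix.updateRow_apply]
  split_ifs <;> simp_all

section Multilinear

variable {R : Type*} [Ring R]

lemma detP_updateRow_zero {n : ℕ} (H : Matrix (Fin (n + 1)) (Fin (n + 1)) R) (u : Fin (n + 1) → R) :
    detP (H.updateRow 0 u) = detP (H.submatrix Fin.succ Fin.succ) * u 0 -
      ∑ a, detP ((H.submatrix Fin.succ Fin.succ).updateRow a fun c => H a.succ 0 * u c.succ) := by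
  have h : (H.updateRow 0 u).submatrix Fin.succ Fin.succ = H.submatrix Fin.succ Fin.succ := by
    ext a b
    simp [Matrix.updateRow_apply]
  rw [detP_succ, h]
  simp [Matrix.updateRow_apply]

/-- In the recursion the term `a = i` overwrites row `i` and sees only `u 0`; every other term keeps
`u` as a row. Thus `u` enters each term once, which makes induction on the size possible. -/
lemma detP_updateRow_succ {n : ℕ} (H : Matrix (Fin (n + 1)) (Fin (n + 1)) R) (i : Fin n)
    (u : Fin (n + 1) → R) :
    detP (H.updateRow i.succ u) =
      detP ((H.submatrix Fin.succ Fin.succ).updateRow i fun c => u c.succ) * H 0 0 -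
      (detP ((H.submatrix Fin.succ Fin.succ).updateRow i fun c => u 0 * H 0 c.succ) +
        ∑ a ∈ Finset.univ.erase i, detP (((H.submatrix Fin.succ Fin.succ).updateRow a
          fun c => H a.succ 0 * H 0 c.succ).updateRow i fun c => u c.succ)) := by
  have h : (H.updateRow i.succ u).submatrix Fin.succ Fin.succ =
      (H.submatrix Fin.succ Fin.succ).updateRow i fun c => u c.succ := by
    ext a b
    simp [Matrix.updateRow_apply]
  rw [detP_succ, h, ← Finset.add_sum_erase _ _ (Finset.mem_univ i)]
  congr 2
  · rw [Matrix.updateRow_ne (Fin.succ_ne_zero i).symm, Matrix.updateRow_self,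
      Matrix.updateRow_idem]
  · refine Finset.sum_congr rfl fun a ha => ?_
    have hai : a ≠ i := Finset.ne_of_mem_erase ha
    rw [updateRow_updateRow_comm hai.symm]
    rw [Matrix.updateRow_ne (Fin.succ_ne_zero i).symm,
      Matrix.updateRow_ne ((Fin.succ_injective _).ne hai)]

lemma detP_updateRow_add {n : ℕ} (H : Matrix (Fin n) (Fin n) R) (i : Fin n) (u v : Fin n → R) :
    detP (H.updateRow i (u + v)) = detP (H.updateRow i u) + detP (H.updateRow i v) := by
  induction n with
  | zero => exact i.elim0
  | succ n ih =>
    have ih' (H : Matrix (Fin n) (Fin n) R) (i : Fin n) (u v : Fin n → R) :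
        detP (H.updateRow i fun c => u c + v c) = detP (H.updateRow i u) + detP (H.updateRow i v) :=
      ih H i u v
    refine Fin.cases ?_ (fun i => ?_) i
    · simp only [detP_updateRow_zero, Pi.add_apply, mul_add, ih', Finset.sum_add_distrib]
      abel
    · simp only [detP_updateRow_succ, Pi.add_apply, add_mul, ih', Finset.sum_add_distrib]
      abel

lemma detP_updateRow_smul {S : Type*} [CommRing S] [Algebra S R] {n : ℕ}
    (H : Matrix (Fin n) (Fin n) R) (i : Fin n) (s : S) (u : Fin n → R) :
    detP (H.updateRow i (s • u)) = s • detP (H.updateRow i u) := by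
  induction n with
  | zero => exact i.elim0
  | succ n ih =>
    have ih' (H : Matrix (Fin n) (Fin n) R) (i : Fin n) (u : Fin n → R) :
        detP (H.updateRow i fun c => s • u c) = s • detP (H.updateRow i u) := ih H i u
    refine Fin.cases ?_ (fun i => ?_) i
    · simp only [detP_updateRow_zero, Pi.smul_apply, mul_smul_comm, ih', Finset.smul_sum, smul_sub]
    · simp only [detP_updateRow_succ, Pi.smul_apply, smul_mul_assoc, ih', Finset.smul_sum, smul_sub,
        smul_add]

/-- The derivative of `det_P` at `H` in the direction `K`. -/
def detPDeriv {n : ℕ} (H K : Matrix (Fin n) (Fin n) R) : R :=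
  ∑ a, detP (H.updateRow a (K a))

lemma detP_succ_eq_detPDeriv {n : ℕ} (H : Matrix (Fin (n + 1)) (Fin (n + 1)) R) :
    detP H = detP (H.submatrix Fin.succ Fin.succ) * H 0 0 -
      detPDeriv (H.submatrix Fin.succ Fin.succ)
        (Matrix.vecMulVec (fun a => H a.succ 0) fun c => H 0 c.succ) :=
  detP_succ H

lemma detPDeriv_add {n : ℕ} (H K L : Matrix (Fin n) (Fin n) R) :
    detPDeriv H (K + L) = detPDeriv H K + detPDeriv H L := by
  simp only [detPDeriv, ← Finset.sum_add_distrib]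
  exact Finset.sum_congr rfl fun a _ => detP_updateRow_add H a (K a) (L a)

end Multilinear

/-! ### Differentiating `detP` -/

section Calculus

open Filter Topology

instance : StarModule ℝ ℍ :=
  ⟨fun r a => (Quaternion.star_smul r a).trans (by rw [star_trivial r])⟩

lemma continuous_detP {n : ℕ} : Continuous (detP : Matrix (Fin n) (Fin n) ℍ → ℍ) := by
  unfold detP
  refine continuous_finsetSum _ fun σ _ => continuous_const.mul ?_
  refine continuous_list_prod _ fun m _ => ?_
  refine continuous_list_prod _ fun k _ => ?_
  exact continuous_id.matrix_elem _ _

/-- `det_P` as a real-multilinear function of the rows. -/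
noncomputable def detPMultilinear (n : ℕ) :
    ContinuousMultilinearMap ℝ (fun _ : Fin n => Fin n → ℍ) ℍ where
  toFun H := detP (Matrix.of H)
  map_update_add' := by
    intro inst H i u v
    rw [Subsingleton.elim inst (instDecidableEqFin n)]
    exact detP_updateRow_add (Matrix.of H) i u v
  map_update_smul' := by
    intro inst H i s u
    rw [Subsingleton.elim inst (instDecidableEqFin n)]
    exact detP_updateRow_smul (Matrix.of H) i s u
  cont := continuous_detP

lemma hasDerivWithinAt_detP {n : ℕ} {H : ℝ → Matrix (Fin n) (Fin n) ℍ}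
    {K : Matrix (Fin n) (Fin n) ℍ} {I : Set ℝ} {t : ℝ}
    (h : ∀ i j, HasDerivWithinAt (fun s => H s i j) (K i j) I t) :
    HasDerivWithinAt (fun s => detP (H s)) (detPDeriv (H t) K) I t := by
  have h1 : HasDerivWithinAt (fun s => (H s : Fin n → Fin n → ℍ)) (K : Fin n → Fin n → ℍ) I t :=
    hasDerivWithinAt_pi.2 fun i => hasDerivWithinAt_pi.2 fun j => h i j
  have h2 := ((detPMultilinear n).hasFDerivAt (x := H t)).comp_hasDerivWithinAt t h1
  rw [show detPDeriv (H t) K = (detPMultilinear n).linearDeriv (H t) K from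
    (ContinuousMultilinearMap.linearDeriv_apply (detPMultilinear n) (H t) K).symm]
  exact h2

/-- A scaling law for `det_P` on Hermitian matrices may be differentiated. -/
lemma detPDeriv_map_of_detP_map {n m : ℕ}
    (L : Matrix (Fin n) (Fin n) ℍ →ₗ[ℝ] Matrix (Fin m) (Fin m) ℍ) (c : ℝ)
    (hL : ∀ H : Matrix (Fin n) (Fin n) ℍ, H.IsHermitian → detP (L H) = c • detP H)
    {H K : Matrix (Fin n) (Fin n) ℍ} (hH : H.IsHermitian) (hK : K.IsHermitian) :
    detPDeriv (L H) (L K) = c • detPDeriv H K := by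
  have hline {k : ℕ} (P Q : Matrix (Fin k) (Fin k) ℍ) :
      HasDerivAt (fun s : ℝ => detP (P + s • Q)) (detPDeriv P Q) 0 := by
    have := hasDerivWithinAt_detP (H := fun s : ℝ => P + s • Q) (K := Q) (I := Set.univ) (t := 0)
      fun i j => by
        simpa [-hasDerivWithinAt_univ] using (((hasDerivAt_id (0 : ℝ)).smul_const
          (Q i j)).const_add (P i j)).hasDerivWithinAt (s := Set.univ)
    simpa [hasDerivWithinAt_univ] using this
  have h1 := hline (L H) (L K)
  have h2 := (hline H K).const_smul c
  -- The law holds along the whole real line `H + s • K`, which stays Hermitian, so the derivatives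
  -- at 0 agree.
  refine h1.unique ?_
  refine h2.congr_of_eventuallyEq (Eventually.of_forall fun s => ?_)
  have hs : (H + s • K).IsHermitian := by
    unfold Matrix.IsHermitian
    rw [Matrix.conjTranspose_add, Matrix.conjTranspose_smul, hH.eq, hK.eq, star_trivial]
  simp only [Pi.smul_apply, ← hL _ hs, map_add, map_smul]

end Calculus

/-! ### Invariance under relabelling -/

/-- Expansion of `det_P` by removal of the two smallest letters. -/
lemma detP_succ_succ {R : Type*} [Ring R] {n : ℕ} (H : Matrix (Fin (n + 2)) (Fin (n + 2)) R)
    (G : Matrix (Fin n) (Fin n) R) (hG : ∀ a c, G a c = H a.succ.succ c.succ.succ) :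
    detP H =
      (detP G * H 1 1 -
        ∑ a, detP (G.updateRow a fun c => H a.succ.succ 1 * H 1 c.succ.succ)) * H 0 0 -
      ((detP G * (H 1 0 * H 0 1) -
        ∑ a, detP (G.updateRow a fun c => H a.succ.succ 1 * (H 1 0 * H 0 c.succ.succ))) +
      ∑ a, (detP (G.updateRow a fun c => H a.succ.succ 0 * H 0 c.succ.succ) * H 1 1 -
        (detP (G.updateRow a fun c => H a.succ.succ 0 * H 0 1 * H 1 c.succ.succ) +
          ∑ b ∈ Finset.univ.erase a,
            detP ((G.updateRow b fun c => H b.succ.succ 1 * H 1 c.succ.succ).updateRow a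
              fun c => H a.succ.succ 0 * H 0 c.succ.succ)))) := by
  obtain rfl : G = (H.submatrix Fin.succ Fin.succ).submatrix Fin.succ Fin.succ := by
    ext a c
    exact hG a c
  rw [detP_succ, Fin.sum_univ_succ, detP_updateRow_zero, detP_succ (H.submatrix Fin.succ Fin.succ)]
  simp only [detP_updateRow_succ]
  rfl

/-- The two-letter expansion is symmetric in 0 and 1: the diagonal entries are real, `H 0 1`
commutes with its conjugate `H 1 0`, and replacements of distinct rows commute. -/
lemma detP_submatrix_swap_zero_one {n : ℕ} {H : Matrix (Fin (n + 2)) (Fin (n + 2)) ℍ}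
    (hH : H.IsHermitian) :
    detP (H.submatrix (Equiv.swap 0 1) (Equiv.swap 0 1)) = detP H := by
  have hs (a : Fin n) : Equiv.swap (0 : Fin (n + 2)) 1 a.succ.succ = a.succ.succ :=
    Equiv.swap_apply_of_ne_of_ne (Fin.succ_ne_zero _) (by simp [Fin.ext_iff])
  set G : Matrix (Fin n) (Fin n) ℍ := H.submatrix (fun a => a.succ.succ) fun a => a.succ.succ
  rw [detP_succ_succ (H.submatrix (Equiv.swap 0 1) (Equiv.swap 0 1)) G (fun a c => by simp [hs, G]),
    detP_succ_succ H G (fun a c => rfl)]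
  simp only [Matrix.submatrix_apply, hs, Equiv.swap_apply_left, Equiv.swap_apply_right]
  obtain ⟨p, hp⟩ : ∃ p : ℝ, H 0 0 = p := ⟨_, Quaternion.star_eq_self.1 (hH.apply 0 0)⟩
  obtain ⟨q, hq⟩ : ∃ q : ℝ, H 1 1 = q := ⟨_, Quaternion.star_eq_self.1 (hH.apply 1 1)⟩
  have h01 : H 1 0 * H 0 1 = H 0 1 * H 1 0 := by
    rw [← hH.apply 1 0, Quaternion.star_mul_self, Quaternion.self_mul_star]
  have hsum : (∑ a, ∑ b ∈ Finset.univ.erase a,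
      detP ((G.updateRow b fun c => H b.succ.succ 0 * H 0 c.succ.succ).updateRow a
        fun c => H a.succ.succ 1 * H 1 c.succ.succ)) =
      ∑ a, ∑ b ∈ Finset.univ.erase a,
      detP ((G.updateRow b fun c => H b.succ.succ 1 * H 1 c.succ.succ).updateRow a
        fun c => H a.succ.succ 0 * H 0 c.succ.succ) := by
    rw [Finset.sum_comm' (t' := Finset.univ) (s' := fun b => Finset.univ.erase b)
      (by simp [eq_comm])]
    refine Finset.sum_congr rfl fun a _ => Finset.sum_congr rfl fun b hb => ?_
    rw [updateRow_updateRow_comm (Finset.ne_of_mem_erase hb).symm]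
  simp only [Finset.sum_sub_distrib, Finset.sum_add_distrib, hsum, h01, mul_assoc, hp, hq,
    Quaternion.mul_coe_eq_smul, smul_sub, ← Finset.smul_sum]
  rw [smul_comm p q]
  abel

/-- A linear map acting on the complement of the letter `0` scales `det_P` on Hermitian matrices
as it does in one dimension less. -/
lemma detP_map_of_detP_map_submatrix {n : ℕ}
    {L : Matrix (Fin n) (Fin n) ℍ →ₗ[ℝ] Matrix (Fin n) (Fin n) ℍ} {c : ℝ}
    (hL : ∀ H : Matrix (Fin n) (Fin n) ℍ, H.IsHermitian → detP (L H) = c • detP H)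
    {H K : Matrix (Fin (n + 1)) (Fin (n + 1)) ℍ} (hH : H.IsHermitian)
    (hsub : K.submatrix Fin.succ Fin.succ = L (H.submatrix Fin.succ Fin.succ))
    (hzero : K 0 0 = H 0 0)
    (hvec : Matrix.vecMulVec (fun a : Fin n => K a.succ 0) (fun b : Fin n => K 0 b.succ) =
      L (Matrix.vecMulVec (fun a => H a.succ 0) fun b => H 0 b.succ)) :
    detP K = c • detP H := by
  have hH' : (H.submatrix (Fin.succ : Fin n → _) Fin.succ).IsHermitian := hH.submatrix _
  rw [detP_succ_eq_detPDeriv, detP_succ_eq_detPDeriv H, hsub, hzero, hvec, hL _ hH',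
    detPDeriv_map_of_detP_map L c hL hH', smul_sub, smul_mul_assoc]
  refine Matrix.IsHermitian.ext fun i j => ?_
  simp only [Matrix.vecMulVec_apply, star_mul, hH.apply]

/-- Simultaneous relabelling of rows and columns. -/
noncomputable def submatrixLinearMap {n : ℕ} (e : Equiv.Perm (Fin n)) :
    Matrix (Fin n) (Fin n) ℍ →ₗ[ℝ] Matrix (Fin n) (Fin n) ℍ where
  toFun H := H.submatrix e e
  map_add' _ _ := rfl
  map_smul' _ _ := rfl

/-- Adjacent transpositions generate. All but the first fix the letter 0 and descend to the minor.
-/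
theorem detP_submatrix_perm {n : ℕ} (e : Equiv.Perm (Fin n)) {H : Matrix (Fin n) (Fin n) ℍ}
    (hH : H.IsHermitian) : detP (H.submatrix e e) = detP H := by
  induction n with
  | zero => rw [detP_zero, detP_zero]
  | succ n ih =>
    have he : e ∈ Submonoid.closure
        (Set.range fun i : Fin n => Equiv.swap i.castSucc i.succ) := by
      rw [Equiv.Perm.mclosure_swap_castSucc_succ]
      trivial
    induction he using Submonoid.closure_induction generalizing H with
    | one => rfl
    | mul e f _ _ he hf =>
      have : H.submatrix (e * f) (e * f) = (H.submatrix e e).submatrix f f := rfl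
      rw [this, hf (hH.submatrix _), he hH]
    | mem e he =>
      obtain ⟨i, rfl⟩ := he
      cases n with
      | zero => exact i.elim0
      | succ n =>
        refine Fin.cases ?_ (fun i => ?_) i
        · exact detP_submatrix_swap_zero_one hH
        · have hs (a : Fin (n + 1)) : Equiv.swap i.succ.castSucc i.succ.succ a.succ =
              (Equiv.swap i.castSucc i.succ a).succ := by
            rw [← Fin.succ_castSucc]
            exact ((Fin.succ_injective _).swap_apply _ _ _)
          have h0 : Equiv.swap i.succ.castSucc i.succ.succ 0 = 0 :=
            Equiv.swap_apply_of_ne_of_ne (by simp [Fin.ext_iff]) (Fin.succ_ne_zero _).symm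
          have := detP_map_of_detP_map_submatrix
            (L := submatrixLinearMap (Equiv.swap i.castSucc i.succ)) (c := 1)
            (K := H.submatrix (Equiv.swap i.succ.castSucc i.succ.succ)
              (Equiv.swap i.succ.castSucc i.succ.succ))
            (fun H hH => by rw [one_smul]; exact ih _ hH) hH
            (Matrix.ext fun a b => by simp only [Matrix.submatrix_apply, hs]; rfl)
            (by simp only [Matrix.submatrix_apply, h0])
            (Matrix.ext fun a b => by
              simp only [Matrix.submatrix_apply, Matrix.vecMulVec_apply, hs, h0]; rfl)
          rwa [one_smul] at this

/-! ### Scaling under elementary congruences -/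

/-- The congruence `H ↦ gᴴ H g`. -/
noncomputable def congruence {n : ℕ} (g : Matrix (Fin n) (Fin n) ℍ) :
    Matrix (Fin n) (Fin n) ℍ →ₗ[ℝ] Matrix (Fin n) (Fin n) ℍ :=
  LinearMap.mulLeft ℝ gᴴ ∘ₗ LinearMap.mulRight ℝ g

lemma congruence_apply {n : ℕ} (g H : Matrix (Fin n) (Fin n) ℍ) :
    congruence g H = gᴴ * (H * g) := rfl

lemma detP_fin_one {R : Type*} [Ring R] (H : Matrix (Fin 1) (Fin 1) R) : detP H = H 0 0 := by
  rw [detP_succ, detP_zero]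
  simp

lemma detP_fin_two {R : Type*} [Ring R] (H : Matrix (Fin 2) (Fin 2) R) :
    detP H = H 1 1 * H 0 0 - H 1 0 * H 0 1 := by
  rw [detP_succ, detP_fin_one]
  simp [detP_fin_one]

lemma detP_congruence_fin_one (q : ℍ) {H : Matrix (Fin 1) (Fin 1) ℍ} (hH : H.IsHermitian) :
    detP (congruence (1 + Matrix.single 0 0 q) H) = Quaternion.normSq (1 + q) • detP H := by
  obtain ⟨a, ha⟩ : ∃ a : ℝ, H 0 0 = a := ⟨_, Quaternion.star_eq_self.1 (hH.apply 0 0)⟩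
  have hg : (1 + Matrix.single (0 : Fin 1) (0 : Fin 1) q) 0 0 = 1 + q := by
    rw [Matrix.add_apply, Matrix.one_apply_eq, Matrix.single_apply_same]
  rw [congruence_apply, detP_fin_one, detP_fin_one]
  simp only [Matrix.mul_apply, Fin.sum_univ_one, Matrix.conjTranspose_apply, hg, ha]
  rw [Quaternion.coe_commutes, ← mul_assoc, Quaternion.star_mul_self, Quaternion.coe_mul_eq_smul]

lemma detP_congruence_fin_two {i j : Fin 2} (hij : i ≠ j) (q : ℍ) {H : Matrix (Fin 2) (Fin 2) ℍ}
    (hH : H.IsHermitian) : detP (congruence (1 + Matrix.single i j q) H) = detP H := by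
  obtain ⟨a, ha⟩ : ∃ a : ℝ, H 0 0 = a := ⟨_, Quaternion.star_eq_self.1 (hH.apply 0 0)⟩
  obtain ⟨d, hd⟩ : ∃ d : ℝ, H 1 1 = d := ⟨_, Quaternion.star_eq_self.1 (hH.apply 1 1)⟩
  have hb : H 1 0 = star (H 0 1) := (hH.apply 1 0).symm
  rw [congruence_apply, detP_fin_two, detP_fin_two]
  generalize hc : H 0 1 = b at hb ⊢
  fin_cases i <;> fin_cases j
  · exact absurd rfl hij
  · simp [Matrix.mul_apply, Fin.sum_univ_two, ha, hd, hb, hc, Matrix.one_apply, Matrix.single]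
    ext <;> simp <;> ring
  · simp [Matrix.mul_apply, Fin.sum_univ_two, ha, hd, hb, hc, Matrix.one_apply, Matrix.single]
    ext <;> simp <;> ring
  · exact absurd rfl hij

/-- The matrix is block diagonal with blocks 1 and g', so it fixes the corner and acts as g' both on
the minor and on the outer product of the remaining column and row. -/
lemma detP_congruence_succ {n : ℕ} (i j : Fin n) (q : ℍ) (c : ℝ)
    (h : ∀ H : Matrix (Fin n) (Fin n) ℍ, H.IsHermitian →
      detP (congruence (1 + Matrix.single i j q) H) = c • detP H)
    {H : Matrix (Fin (n + 1)) (Fin (n + 1)) ℍ} (hH : H.IsHermitian) :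
    detP (congruence (1 + Matrix.single i.succ j.succ q) H) = c • detP H := by
  have g00 : (1 + Matrix.single i.succ j.succ q) 0 0 = 1 := by
    simp [Matrix.single]
  have gs0 (a : Fin n) : (1 + Matrix.single i.succ j.succ q) a.succ 0 = 0 := by
    simp [Matrix.single]
  have g0s (a : Fin n) : (1 + Matrix.single i.succ j.succ q) 0 a.succ = 0 := by
    simp [Matrix.single, (Fin.succ_ne_zero a).symm]
  have gss (a b : Fin n) : (1 + Matrix.single i.succ j.succ q) a.succ b.succ =
      (1 + Matrix.single i j q) a b := by
    simp [Matrix.single, Matrix.one_apply]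
  generalize 1 + Matrix.single i.succ j.succ q = g at *
  generalize 1 + Matrix.single i j q = g' at *
  refine detP_map_of_detP_map_submatrix h hH ?_ ?_ ?_
  · refine Matrix.ext fun a b => ?_
    simp only [congruence_apply, Matrix.submatrix_apply, Matrix.mul_apply, Fin.sum_univ_succ,
      Matrix.conjTranspose_apply, g0s, gss, star_zero, zero_mul, mul_zero, zero_add]
  · simp [congruence_apply, Matrix.mul_apply, Fin.sum_univ_succ, g00, gs0]
  · rw [congruence_apply g', Matrix.vecMulVec_mul, Matrix.mul_vecMulVec]
    refine Matrix.ext fun a b => ?_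
    simp only [congruence_apply, Matrix.vecMulVec_apply, Matrix.mul_apply, Fin.sum_univ_succ,
      Matrix.conjTranspose_apply, g00, gs0, g0s, gss, star_zero, zero_mul, mul_zero, zero_add,
      Finset.sum_const_zero, add_zero, mul_one, star_one, one_mul, Matrix.mulVec, Matrix.vecMul,
      dotProduct]

theorem detP_congruence {n : ℕ} (i j : Fin n) (q : ℍ) {H : Matrix (Fin n) (Fin n) ℍ}
    (hH : H.IsHermitian) : detP (congruence (1 + Matrix.single i j q) H) =
      (if i = j then Quaternion.normSq (1 + q) else 1 : ℝ) • detP H := by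
  induction n with
  | zero => exact i.elim0
  | succ n ih =>
    by_cases hk : ∃ k, k ≠ i ∧ k ≠ j
    · obtain ⟨k, hki, hkj⟩ := hk
      -- Relabel so that the untouched letter `k` becomes 0.
      set e := Equiv.swap 0 k with he
      have hee (l : Fin (n + 1)) : e (e l) = l := Equiv.swap_apply_self 0 k l
      have hne {l : Fin (n + 1)} (hl : k ≠ l) : e l ≠ 0 := fun h => hl <| by
        rw [← Equiv.swap_apply_left 0 k, ← he, ← h, hee]
      obtain ⟨i', hi⟩ := Fin.exists_succ_eq.2 (hne hki)
      obtain ⟨j', hj⟩ := Fin.exists_succ_eq.2 (hne hkj)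
      have hij : i = j ↔ i' = j' := by
        rw [← Fin.succ_inj (a := i'), hi, hj, e.injective.eq_iff]
      have hsub : (congruence (1 + Matrix.single i j q) H).submatrix e e =
          congruence (1 + Matrix.single i'.succ j'.succ q) (H.submatrix e e) := by
        have hg : (1 + Matrix.single i j q).submatrix e e = 1 + Matrix.single i'.succ j'.succ q := by
          have hl (l a : Fin (n + 1)) : l = e a ↔ e l = a :=
            ⟨fun h => h ▸ hee a, fun h => h ▸ (hee l).symm⟩
          refine Matrix.ext fun a b => ?_
          simp only [Matrix.submatrix_apply, Matrix.add_apply, Matrix.single_apply,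
            Matrix.one_apply, hi, hj, hl i, hl j, e.injective.eq_iff]
        rw [congruence_apply, congruence_apply, ← hg, Matrix.conjTranspose_submatrix,
          Matrix.submatrix_mul_equiv, Matrix.submatrix_mul_equiv]
      have hK : (congruence (1 + Matrix.single i j q) H).IsHermitian := by
        rw [congruence_apply, ← mul_assoc]
        exact Matrix.isHermitian_conjTranspose_mul_mul _ hH
      rw [← detP_submatrix_perm e hK, hsub, detP_congruence_succ i' j' q _ (fun H hH => ih i' j' hH)
        (hH.submatrix _), detP_submatrix_perm e hH]
      simp only [hij]
    · push Not at hk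
      -- With no spare letter, the indices `i` and `j` exhaust everything.
      have hcard : n + 1 ≤ 2 := by
        have h1 : (Finset.univ : Finset (Fin (n + 1))) ⊆ {i, j} := fun k _ => by
          by_cases h : k = i
          · simp [h]
          · simp [hk k h]
        simpa using (Finset.card_le_card h1).trans Finset.card_le_two
      obtain rfl | rfl : n = 0 ∨ n = 1 := by omega
      · obtain rfl := Fin.fin_one_eq_zero i
        obtain rfl := Fin.fin_one_eq_zero j
        rw [if_pos rfl]
        exact detP_congruence_fin_one q hH
      · have hij : i ≠ j := by
          rintro rfl
          have := hk (i + 1)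
          revert this
          fin_cases i <;> simp
        rw [if_neg hij, one_smul, detP_congruence_fin_two hij q hH]

/-! ### The infinitesimal scaling law -/

lemma re_trace_mul_comm {n : ℕ} (A B : Matrix (Fin n) (Fin n) ℍ) :
    (A * B).trace.re = (B * A).trace.re := by
  have hre (s : Finset (Fin n)) (f : Fin n → ℍ) : (∑ i ∈ s, f i).re = ∑ i ∈ s, (f i).re :=
    map_sum (AddMonoidHom.mk' (fun q : ℍ => q.re) fun _ _ => rfl) f s
  simp only [Matrix.trace, Matrix.diag_apply, Matrix.mul_apply, hre]
  rw [Finset.sum_comm]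
  refine Finset.sum_congr rfl fun i _ => Finset.sum_congr rfl fun j _ => ?_
  simp only [Quaternion.re_mul]
  ring

/-- Differentiate the scaling law at `s = 0` along congruences by `1 + s • E`; the factor `|1 +
sq|²` has derivative `2 Re q`. -/
lemma detPDeriv_single {n : ℕ} (i j : Fin n) (q : ℍ) {H : Matrix (Fin n) (Fin n) ℍ}
    (hH : H.IsHermitian) :
    detPDeriv H ((Matrix.single i j q)ᴴ * H + H * Matrix.single i j q) =
      (2 * (Matrix.single i j q).trace.re) • detP H := by
  set E := Matrix.single i j q with hE
  have hcurve (s : ℝ) : congruence (1 + Matrix.single i j (s • q)) H =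
      H + s • (Eᴴ * H + H * E) + s ^ 2 • (Eᴴ * H * E) := by
    rw [← Matrix.smul_single, ← hE, congruence_apply, Matrix.conjTranspose_add,
      Matrix.conjTranspose_one, Matrix.conjTranspose_smul, star_trivial]
    simp only [add_mul, mul_add, one_mul, mul_one, Matrix.mul_smul, Matrix.smul_mul, smul_smul,
      smul_add, sq, mul_assoc]
    abel
  have h1 : HasDerivAt (fun s : ℝ => detP (congruence (1 + Matrix.single i j (s • q)) H))
      (detPDeriv H (Eᴴ * H + H * E)) 0 := by
    have := hasDerivWithinAt_detP (H := fun s : ℝ => H + s • (Eᴴ * H + H * E) +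
      s ^ 2 • (Eᴴ * H * E)) (K := Eᴴ * H + H * E) (I := Set.univ) (t := 0) fun a b => by
        have h1 := ((hasDerivAt_id (0 : ℝ)).smul_const ((Eᴴ * H + H * E) a b)).const_add (H a b)
        have h2 := ((hasDerivAt_id (0 : ℝ)).pow 2).smul_const ((Eᴴ * H * E) a b)
        simpa [-hasDerivWithinAt_univ] using (h1.fun_add h2).hasDerivWithinAt (s := Set.univ)
    simpa [hasDerivWithinAt_univ, hcurve] using this
  have h2 : HasDerivAt (fun s : ℝ => (if i = j then Quaternion.normSq (1 + s • q) else 1 : ℝ))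
      (2 * E.trace.re) 0 := by
    split_ifs with hij
    · subst hij
      have h (s : ℝ) : Quaternion.normSq (1 + s • q) =
          1 + s * (2 * q.re) + s ^ 2 * Quaternion.normSq q := by
        simp only [Quaternion.normSq_def', Quaternion.re_add, Quaternion.imI_add,
          Quaternion.imJ_add, Quaternion.imK_add, Quaternion.re_smul, Quaternion.imI_smul,
          Quaternion.imJ_smul, Quaternion.imK_smul, Quaternion.re_one, Quaternion.imI_one,
          Quaternion.imJ_one, Quaternion.imK_one, smul_eq_mul]
        ring
      have h3 := (((hasDerivAt_id (0 : ℝ)).mul_const (2 * q.re)).const_add 1).add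
        (((hasDerivAt_id (0 : ℝ)).pow 2).mul_const (Quaternion.normSq q))
      have h4 : E.trace.re = q.re := by rw [hE, Matrix.trace_single_eq_same]
      rw [h4]
      refine (h3.congr_deriv (by simp)).congr_of_eventuallyEq (Filter.Eventually.of_forall fun s => ?_)
      simp [h]
    · rw [hE, Matrix.trace_single_eq_of_ne _ _ _ hij, Quaternion.re_zero, mul_zero]
      exact hasDerivAt_const _ _
  refine h1.unique ((h2.smul_const (detP H)).congr_of_eventuallyEq
    (Filter.Eventually.of_forall fun s => ?_))
  exact detP_congruence i j (s • q) hH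

theorem detPDeriv_conjTranspose_mul_add_mul {n : ℕ} (B : Matrix (Fin n) (Fin n) ℍ)
    {H : Matrix (Fin n) (Fin n) ℍ} (hH : H.IsHermitian) :
    detPDeriv H (Bᴴ * H + H * B) = (2 * B.trace.re) • detP H := by
  induction B using Matrix.induction_on' with
  | h_zero =>
    have h := detPDeriv_add H 0 0
    rw [add_zero, left_eq_add] at h
    simp [h]
  | h_add B C hB hC =>
    rw [Matrix.conjTranspose_add, add_mul, mul_add, add_add_add_comm, detPDeriv_add, hB, hC,
      Matrix.trace_add, Quaternion.re_add, mul_add, add_smul]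
  | h_std_basis i j q => exact detPDeriv_single i j q hH

/-- Take B = M⁻¹AM, so that MB = AM. The trace itself is not a similarity invariant over the
quaternions, but its real part is. -/
lemma detPDeriv_of_isUnit {n : ℕ} (A : Matrix (Fin n) (Fin n) ℍ) {M : Matrix (Fin n) (Fin n) ℍ}
    (hM : IsUnit M) :
    detPDeriv (Mᴴ * M) ((A * M)ᴴ * M + Mᴴ * (A * M)) = (2 * A.trace.re) • detP (Mᴴ * M) := by
  obtain ⟨u, rfl⟩ := hM
  have h := detPDeriv_conjTranspose_mul_add_mul
    ((↑u⁻¹ : Matrix (Fin n) (Fin n) ℍ) * (A * (u : Matrix (Fin n) (Fin n) ℍ)))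
    (Matrix.isHermitian_conjTranspose_mul_self (u : Matrix (Fin n) (Fin n) ℍ))
  have htr : ((↑u⁻¹ : Matrix (Fin n) (Fin n) ℍ) * (A * (u : Matrix (Fin n) (Fin n) ℍ))).trace.re =
      A.trace.re := by
    rw [re_trace_mul_comm, mul_assoc, Units.mul_inv, mul_one]
  rw [htr] at h
  have hB : (u : Matrix (Fin n) (Fin n) ℍ) *
      ((↑u⁻¹ : Matrix (Fin n) (Fin n) ℍ) * (A * (u : Matrix (Fin n) (Fin n) ℍ))) =
      A * (u : Matrix (Fin n) (Fin n) ℍ) := Units.mul_inv_cancel_left _ _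
  rw [mul_assoc _ _ (_ * _), ← mul_assoc _ _ᴴ _, ← Matrix.conjTranspose_mul, hB] at h
  exact h

lemma finite_spectrum_of_finite {K V : Type*} [Field K] [Ring V] [Algebra K V] [Module.Finite K V]
    (a : V) : (spectrum K a).Finite := by
  have hint : IsIntegral K a := Algebra.IsIntegral.isIntegral a
  refine (Polynomial.finite_setOfPred_isRoot (minpoly.ne_zero hint)).subset fun s hs => ?_
  have h := spectrum.subset_polynomial_aeval a (minpoly K a) ⟨s, hs, rfl⟩
  rw [minpoly.aeval] at h
  by_contra hne
  refine h ?_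
  change IsUnit (algebraMap K V _ - 0)
  rw [sub_zero]
  exact (IsUnit.mk0 _ hne).map (algebraMap K V)

theorem detPDeriv_conjTranspose_mul_self {n : ℕ} (A M : Matrix (Fin n) (Fin n) ℍ) :
    detPDeriv (Mᴴ * M) ((A * M)ᴴ * M + Mᴴ * (A * M)) = (2 * A.trace.re) • detP (Mᴴ * M) := by
  -- `M + s` is invertible for all but finitely many real `s`, and both sides are continuous in `s`;
  -- evaluate at `s = 0`.
  set N : ℝ → Matrix (Fin n) (Fin n) ℍ := fun s => algebraMap ℝ _ s + M with hN
  have hNc : Continuous N := by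
    have : Continuous fun s : ℝ => algebraMap ℝ (Matrix (Fin n) (Fin n) ℍ) s := by
      simp only [Algebra.algebraMap_eq_smul_one]
      fun_prop
    exact this.add continuous_const
  have hd : Dense (spectrum ℝ (-M))ᶜ := (finite_spectrum_of_finite (-M)).countable.dense_compl ℝ
  have h1 : Continuous fun s => detPDeriv ((N s)ᴴ * N s) ((A * N s)ᴴ * N s + (N s)ᴴ * (A * N s)) := by
    unfold detPDeriv
    refine continuous_finsetSum _ fun a _ => continuous_detP.comp ?_
    refine Continuous.matrix_updateRow a (by fun_prop) ?_
    have hK : Continuous fun s => (A * N s)ᴴ * N s + (N s)ᴴ * (A * N s) := by fun_prop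
    exact continuous_pi fun b => hK.matrix_elem a b
  have hG : Continuous fun s => (N s)ᴴ * N s := by fun_prop
  have h2 : Continuous fun s => (2 * A.trace.re) • detP ((N s)ᴴ * N s) :=
    (continuous_const_smul (2 * A.trace.re)).comp (continuous_detP.comp hG)
  have h := congrFun (h1.ext_on hd h2 fun s hs => detPDeriv_of_isUnit A ?_) 0
  · simpa [hN] using h
  · have := spectrum.notMem_iff.1 hs
    rwa [sub_neg_eq_add] at this

/-! ### The differential equation of the Wronskian -/

/-- A solution of a scalar homogeneous linear equation on an interval is determined by its value at a point. -/
lemma eq_exp_integral_smul {E : Type*} [NormedAddCommGroup E] [NormedSpace ℝ E] {I : Set ℝ}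
    (hI : I.OrdConnected) {a : ℝ → ℝ} (ha : ContinuousOn a I) {f : ℝ → E}
    (hf : ∀ t ∈ I, HasDerivWithinAt f (a t • f t) I t) {t₀ t : ℝ} (ht₀ : t₀ ∈ I) (ht : t ∈ I) :
    f t = Real.exp (∫ s in t₀..t, a s) • f t₀ := by
  have hJ : Set.uIcc t₀ t ⊆ I := hI.uIcc_subset ht₀ ht
  -- Continuity of `a` is known only on `I`; the constant extension `b` has an antiderivative
  -- differentiable at every point, endpoints included.
  set b : ℝ → ℝ := Set.IccExtend (min_le_max : min t₀ t ≤ max t₀ t)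
    ((Set.Icc (min t₀ t) (max t₀ t)).domRestrict a) with hb
  have hbc : Continuous b :=
    (continuousOn_iff_continuous_domRestrict.1 (ha.mono hJ)).Icc_extend'
  have hba : ∀ s ∈ Set.uIcc t₀ t, b s = a s := fun s hs => Set.IccExtend_of_mem _ _ hs
  have hF (s : ℝ) : HasDerivAt (fun s => ∫ r in t₀..s, b r) (b s) s :=
    (hbc.integral_hasStrictDerivAt t₀ s).hasDerivAt
  -- Integrating factor: the product has zero derivative, hence is constant.
  have hg : ∀ s ∈ Set.uIcc t₀ t,
      HasDerivWithinAt (fun s => Real.exp (-∫ r in t₀..s, b r) • f s) 0 (Set.uIcc t₀ t) s := by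
    intro s hs
    have h := ((hF s).neg.exp.hasDerivWithinAt (s := Set.uIcc t₀ t)).smul
      ((hf s (hJ hs)).mono hJ)
    refine h.congr_deriv ?_
    rw [hba s hs, smul_smul, ← add_smul]
    simp
  have h := (convex_uIcc t₀ t).norm_image_sub_le_of_norm_hasDerivWithin_le (C := 0) hg (by simp)
    Set.left_mem_uIcc Set.right_mem_uIcc
  rw [zero_mul, norm_le_zero_iff, sub_eq_zero, intervalIntegral.integral_same, neg_zero,
    Real.exp_zero, one_smul] at h
  rw [← h, smul_smul, intervalIntegral.integral_congr hba, ← Real.exp_add]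
  simp

lemma hasDerivWithinAt_ddet_solutionMatrix {n : ℕ} {I : Set ℝ} {A : ℝ → Matrix (Fin n) (Fin n) ℍ}
    {x : Fin n → ℝ → Fin n → ℍ} (hx : ∀ j, IsSolutionOn A I (x j)) {t : ℝ} (ht : t ∈ I) :
    HasDerivWithinAt (fun s => ddet (solutionMatrix x s))
      ((2 * (A t).trace.re) • ddet (solutionMatrix x t)) I t := by
  have hM (i j : Fin n) : HasDerivWithinAt (fun s => solutionMatrix x s i j)
      ((A t * solutionMatrix x t) i j) I t :=
    hasDerivWithinAt_pi.1 (hx j t ht) i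
  unfold ddet
  rw [← detPDeriv_conjTranspose_mul_self]
  refine hasDerivWithinAt_detP fun i j => ?_
  have h := HasDerivWithinAt.fun_sum (u := Finset.univ)
    fun k _ => (hM k i).star.fun_mul (hM k j)
  rw [Finset.sum_add_distrib] at h
  exact h

lemma wronskian_eq_exp_smul {n : ℕ} {I : Set ℝ} (hI : I.OrdConnected)
    {A : ℝ → Matrix (Fin n) (Fin n) ℍ} (hA : ContinuousOn A I)
    {x : Fin n → ℝ → Fin n → ℍ} (hx : ∀ j, IsSolutionOn A I (x j)) {t₀ t : ℝ} (ht₀ : t₀ ∈ I)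
    (ht : t ∈ I) :
    wronskian x t = Real.exp (2 * ∫ s in t₀..t, (A s).trace.re) • wronskian x t₀ := by
  have ha : ContinuousOn (fun s => 2 * (A s).trace.re) I :=
    (Quaternion.continuous_re.comp_continuousOn
      ((continuous_id.matrix_trace).comp_continuousOn hA)).const_mul 2
  have h := eq_exp_integral_smul hI ha
    (fun t ht => hasDerivWithinAt_ddet_solutionMatrix hx ht) ht₀ ht
  rw [intervalIntegral.integral_const_mul] at h
  unfold wronskian
  rw [h, smul_comm]

lemma trace_add_trace_conjTranspose {n : ℕ} (A : Matrix (Fin n) (Fin n) ℍ) :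
    A.trace + Aᴴ.trace = (2 * A.trace.re) • (1 : ℍ) := by
  rw [Matrix.trace_conjTranspose, Quaternion.self_add_star, ← Quaternion.coe_mul_eq_smul, mul_one]
  push_cast
  rfl

lemma exp_integral_trace_mul {n : ℕ} (A : ℝ → Matrix (Fin n) (Fin n) ℍ) (t₀ t : ℝ) (w : ℍ) :
    NormedSpace.exp (∫ s in t₀..t, ((A s).trace + ((A s)ᴴ).trace)) * w =
      Real.exp (2 * ∫ s in t₀..t, (A s).trace.re) • w := by
  simp only [trace_add_trace_conjTranspose]
  rw [intervalIntegral.integral_smul_const, intervalIntegral.integral_const_mul,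
    ← Quaternion.coe_mul_eq_smul, mul_one, Quaternion.exp_coe, ← Real.exp_eq_exp_ℝ,
    Quaternion.coe_mul_eq_smul]

end QuatLiouville

theorem theorem4p4 {n : ℕ} {I : Set ℝ} (hI : I.OrdConnected)
    (A : ℝ → Matrix (Fin n) (Fin n) ℍ) (hA : ContinuousOn A I)
    (x : Fin n → ℝ → Fin n → ℍ) (hx : ∀ j, QuatLiouville.IsSolutionOn A I (x j)) :
    (∀ t₀ ∈ I, ∀ t ∈ I,
      QuatLiouville.wronskian x t =
        NormedSpace.exp (∫ s in t₀..t, ((A s).trace + ((A s)ᴴ).trace)) *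
          QuatLiouville.wronskian x t₀) ∧
    (∀ t₀ ∈ I, ∀ t ∈ I,
      QuatLiouville.wronskian x t =
        Real.exp (2 * ∫ s in t₀..t, ((A s).trace).re) • QuatLiouville.wronskian x t₀) ∧
    ((∃ t₀ ∈ I, QuatLiouville.wronskian x t₀ = 0) →
      ∀ t ∈ I, QuatLiouville.wronskian x t = 0) := by
  refine ⟨fun t₀ ht₀ t ht => ?_, fun t₀ ht₀ t ht => ?_, fun ⟨t₀, ht₀, h⟩ t ht => ?_⟩
  · rw [QuatLiouville.exp_integral_trace_mul]
    exact QuatLiouville.wronskian_eq_exp_smul hI hA hx ht₀ ht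
  · exact QuatLiouville.wronskian_eq_exp_smul hI hA hx ht₀ ht
  · rw [QuatLiouville.wronskian_eq_exp_smul hI hA hx ht₀ ht, h, smul_zero]
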